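/- **Setting.** A seller sells items over $T$ stages to one buyer with additive valuations. At stage $t\in\{1,\dots,T\}$ there are $k_t$ items, and the buyer's private type $v_t\in\mathcal V_t=\mathbb R_+^{k_t}$ is drawn from a publicly known distribution $\mathcal F_t$ with finite expectation; the types of different stages are independent. Write $v_{(1,t)}=(v_1,\dots,v_t)$. A *direct mechanism* $M$ consists of (measurable) allocation rules $x_t:\mathcal V_1\times\cdots\times\mathcal V_t\to[0,1]^{k_t}$ and payment rules $p_t:\mathcal V_1\times\cdots\times\mathcal V_t\to\mathbb R$ on the histories of reports. Let $u_t(v_{(1,t)};v)=x_t(v_{(1,t)})\cdot v-p_t(v_{(1,t)})$. A bidding strategy $b$ is a sequence of maps $b_\tau:\mathcal V_1\times\cdots\times\mathcal V_\tau\to\mathcal V_\tau$; let $U^b_t(v_{(1,t)})=\mathbb E_{v_{t+1},\dots,v_T}\big[\sum_{\tau=t+1}^T u_\tau(v_{(1,t)},b_{t+1}(v_{(1,t+1)}),\dots,b_\tau(v_{(1,\tau)});v_\tau)\big]$, and let $U_t$ be this quantity for truthful bidding. $M$ is *IC* if for all $t$, $v_{(1,t)}$, $v'_t\in\mathcal V_t$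 and all bidding strategies $b$, $$u_t(v_{(1,t)};v_t)+U_t(v_{(1,t)})\ \ge\ u_t(v_{(1,t-1)},v'_t;v_t)+U^b_t(v_{(1,t-1)},v'_t),$$ and *ex-post IR* if $\sum_{\tau=1}^T u_\tau(v_{(1,\tau)};v_\tau)\ge 0$ for every $v_{(1,T)}$. It is *deterministic* if every $x_t$ takes values in $\{0,1\}^{k_t}$. Put $\mathrm{Rev}(M)=\mathbb E\big[\sum_t p_t(v_{(1,t)})\big]$ and $\mathrm{Utl}(M)=\mathbb E\big[\sum_t u_t(v_{(1,t)};v_t)\big]$. A *bank account mechanism* consists, for each $t$, of (measurable) functions $z_t:\mathbb R_+\times\mathcal V_t\to[0,1]^{k_t}$, $q_t:\mathbb R_+\times\mathcal V_t\to\mathbb R_+$, $d_t:\mathbb R_+\times\mathcal V_t\to\mathbb R_+$ and $s_t:\mathbb R_+\to\mathbb R$ with $s_t(\beta)\le\beta$. The balance is defined by $\mathrm{bal}_1=0$ and $\mathrm{bal}_{t+1}=\mathrm{bal}_t-s_t(\mathrm{bal}_t)+d_t(\mathrm{bal}_t,v_t)$, and the mechanism is identified with the direct mechanism $x_t=z_t(\mathrm{bal}_t,v_t)$,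 $p_t=s_t(\mathrm{bal}_t)+q_t(\mathrm{bal}_t,v_t)$. With $\hat u_t(\beta,v';v)=z_t(\beta,v')\cdot v-q_t(\beta,v')$, it is called a *BAM* if for all $t$, all $\beta,\beta'\ge 0$ and all $v,v'\in\mathcal V_t$: $$\hat u_t(\beta,v;v)\ge\hat u_t(\beta,v';v),\qquad s_t(\beta)-s_t(\beta')=\mathbb E_{v_t\sim\mathcal F_t}\big[\hat u_t(\beta,v_t;v_t)-\hat u_t(\beta',v_t;v_t)\big],\qquad \hat u_t(\beta,v;v)\ge d_t(\beta,v).$$ It is deterministic if every $z_t$ takes values in $\{0,1\}^{k_t}$. **Theorem.** For every IC and ex-post IR direct mechanism $M$ there is a BAM $B$ with $$\mathrm{Rev}(B)\ge\mathrm{Rev}(M)\qquad\text{and}\qquad\mathrm{Utl}(B)=\mathrm{Utl}(M),$$ all these expectations being finite. Moreover, if $M$ is deterministic, then $B$ can be chosen deterministic as well. -/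

import Mathlib

open MeasureTheory
open scoped NNReal

namespace DynMech

/-- Types of a stage with `m` items: `ℝ₊^m`. -/
abbrev Val (m : ℕ) : Type := Fin m → ℝ≥0

/-- Stage allocations for `m` items: `[0,1]^m`. -/
abbrev Alloc (m : ℕ) : Type := Fin m → unitInterval

/-- The value `x · v` of the allocation `x` to a buyer of type `v`. -/
noncomputable def dot {m : ℕ} (x : Alloc m) (v : Val m) : ℝ :=
  ∑ i, (x i : ℝ) * (v i : ℝ)

section Profiles

variable {T : ℕ} {k : Fin T → ℕ}

/-- Complete type sequences. Stage `t : Fin T` (counted from `0`) has `k t` items. -/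
abbrev Profile (k : Fin T → ℕ) : Type := (t : Fin T) → Val (k t)

/-- Histories of length `n`: the types of the first `n` stages. -/
abbrev History (k : Fin T → ℕ) (n : ℕ) : Type :=
  (i : {i : Fin T // (i : ℕ) < n}) → Val (k i)

/-- The first `n` types of a type sequence. -/
def take (v : Profile k) (n : ℕ) : History k n := fun i => v i

/-- The type sequence with the first `n` types from `h` and the later ones from `w`. -/
def splice {n : ℕ} (h : History k n) (w : Profile k) : Profile k :=
  fun i => if hi : (i : ℕ) < n then h ⟨i, hi⟩ else w i

/-- Bidding strategies: the report at stage `t` as a function of the types up to stage `t`. -/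
abbrev Strategy (k : Fin T → ℕ) : Type := (t : Fin T) → History k (t + 1) → Val (k t)

/-- The strategy that reports the current type. -/
def truthful : Strategy k := fun t h => h ⟨t, Nat.lt_succ_self _⟩

/-- The reports when `v` is reported unchanged in the first `n` stages and `b` is followed from
then on. -/
def report (b : Strategy k) (n : ℕ) (v : Profile k) : Profile k :=
  fun i => if (i : ℕ) < n then v i else b i (take v (i + 1))

/-- Direct mechanisms: (measurable) allocation and payment rules on histories of reports. -/
structure DirectMechanism (k : Fin T → ℕ) where
  alloc : (t : Fin T) → History k (t + 1) → Alloc (k t)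
  pay : (t : Fin T) → History k (t + 1) → ℝ
  measurable_alloc : ∀ t, Measurable (alloc t)
  measurable_pay : ∀ t, Measurable (pay t)

namespace DirectMechanism

/-- The stage utility `u_t(h; v)` of a buyer of current type `v` after the reports `h`. -/
noncomputable def stageUtil (M : DirectMechanism k) (t : Fin T) (h : History k (t + 1))
    (v : Val (k t)) : ℝ :=
  dot (M.alloc t h) v - M.pay t h

/-- The utility from the stages after the first `n`, when `h` was reported in the first `n` stages,
the later true types are those of `w`, and `b` is followed from then on. -/
noncomputable def futureUtil (M : DirectMechanism k) (b : Strategy k) {n : ℕ} (h : History k n)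
    (w : Profile k) : ℝ :=
  ∑ t ∈ Finset.univ.filter (fun t : Fin T => n ≤ (t : ℕ)),
    M.stageUtil t (take (report b n (splice h w)) (t + 1)) (w t)

/-- The expectation of `futureUtil` over independent future types. -/
noncomputable def expUtil (M : DirectMechanism k) (F : (t : Fin T) → Measure (Val (k t)))
    (b : Strategy k) {n : ℕ} (h : History k n) : ℝ :=
  ∫ w, M.futureUtil b h w ∂(Measure.pi F)

/-- Incentive compatibility: after every history, a truthful report followed by truthful bidding is
at least as good as any report `v'` followed by any bidding strategy `b`. Strategies whose expected
utility is not finite are left out; no integrability is presupposed of truthful bidding. -/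
def IsIC (M : DirectMechanism k) (F : (t : Fin T) → Measure (Val (k t))) : Prop :=
  ∀ (t : Fin T) (v : Profile k) (v' : Val (k t)) (b : Strategy k),
    (∀ τ, Measurable (b τ)) →
    Integrable (M.futureUtil b (take (Function.update v t v') (t + 1))) (Measure.pi F) →
    M.stageUtil t (take (Function.update v t v') (t + 1)) (v t)
        + M.expUtil F b (take (Function.update v t v') (t + 1))
      ≤ M.stageUtil t (take v (t + 1)) (v t) + M.expUtil F truthful (take v (t + 1))

/-- The overall utility of a truthful buyer with types `v`. -/
noncomputable def totalUtil (M : DirectMechanism k) (v : Profile k) : ℝ :=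
  ∑ t, M.stageUtil t (take v (t + 1)) (v t)

/-- The overall payment of a truthful buyer with types `v`. -/
noncomputable def totalPay (M : DirectMechanism k) (v : Profile k) : ℝ :=
  ∑ t, M.pay t (take v (t + 1))

/-- Ex-post individual rationality. -/
def IsIR (M : DirectMechanism k) : Prop := ∀ v, 0 ≤ M.totalUtil v

/-- The overall revenue and the overall utility have finite expectations. -/
def HasFiniteExpectations (M : DirectMechanism k) (F : (t : Fin T) → Measure (Val (k t))) : Prop :=
  Integrable M.totalPay (Measure.pi F) ∧ Integrable M.totalUtil (Measure.pi F)

/-- The overall expected revenue. -/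
noncomputable def rev (M : DirectMechanism k) (F : (t : Fin T) → Measure (Val (k t))) : ℝ :=
  ∫ v, M.totalPay v ∂(Measure.pi F)

/-- The overall expected buyer utility. -/
noncomputable def utl (M : DirectMechanism k) (F : (t : Fin T) → Measure (Val (k t))) : ℝ :=
  ∫ v, M.totalUtil v ∂(Measure.pi F)

/-- All allocations lie in `{0,1}^(k t)`. -/
def IsDeterministic (M : DirectMechanism k) : Prop :=
  ∀ t h i, M.alloc t h i = 0 ∨ M.alloc t h i = 1

end DirectMechanism

/-- Bank account mechanisms before any IC or IR constraint: allocation rule `z`, payment rule `q`,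
deposit policy `d` and spend policy `s`, as (measurable) functions of balance and stage type. -/
structure BankAccountMechanism (k : Fin T → ℕ) where
  z : (t : Fin T) → ℝ≥0 → Val (k t) → Alloc (k t)
  q : (t : Fin T) → ℝ≥0 → Val (k t) → ℝ≥0
  d : (t : Fin T) → ℝ≥0 → Val (k t) → ℝ≥0
  s : (t : Fin T) → ℝ≥0 → ℝ
  s_le : ∀ t β, s t β ≤ β
  measurable_z : ∀ t, Measurable (Function.uncurry (z t))
  measurable_q : ∀ t, Measurable (Function.uncurry (q t))
  measurable_d : ∀ t, Measurable (Function.uncurry (d t))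
  measurable_s : ∀ t, Measurable (s t)

namespace BankAccountMechanism

/-- The balance after a stage that starts with balance `β` and has type `v`. -/
noncomputable def update (B : BankAccountMechanism k) (t : Fin T) (β : ℝ≥0) (v : Val (k t)) :
    ℝ≥0 :=
  ⟨β - B.s t β + B.d t β v, add_nonneg (sub_nonneg.2 (B.s_le t β)) (B.d t β v).2⟩

/-- The balance after the first `n` stages; it starts at `0`. -/
noncomputable def bal (B : BankAccountMechanism k) : (n : ℕ) → n ≤ T → History k n → ℝ≥0
  | 0, _, _ => 0
  | n + 1, hn, h =>
      B.update ⟨n, hn⟩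
        (B.bal n (Nat.le_of_succ_le hn) (fun i => h ⟨i, Nat.lt_succ_of_lt i.2⟩))
        (h ⟨⟨n, hn⟩, Nat.lt_succ_self n⟩)

/-- The balance at the beginning of stage `t`, from the history up to and including stage `t`
(whose last entry is not used). -/
noncomputable def balBefore (B : BankAccountMechanism k) (t : Fin T) (h : History k (t + 1)) :
    ℝ≥0 :=
  B.bal t t.2.le (fun i => h ⟨i, Nat.lt_succ_of_lt i.2⟩)

theorem measurable_update (B : BankAccountMechanism k) (t : Fin T) :
    Measurable (Function.uncurry (B.update t)) := by
  have hd := B.measurable_d t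
  have hs := B.measurable_s t
  refine Measurable.subtype_mk ?_
  exact (measurable_fst.coe_nnreal_real.sub (hs.comp measurable_fst)).add hd.coe_nnreal_real

theorem measurable_bal (B : BankAccountMechanism k) :
    ∀ (n : ℕ) (hn : n ≤ T), Measurable (B.bal n hn)
  | 0, _ => measurable_const
  | n + 1, hn => by
      have ih := measurable_bal B n (Nat.le_of_succ_le hn)
      have h1 : Measurable (fun h : History k (n + 1) =>
          B.bal n (Nat.le_of_succ_le hn) (fun i => h ⟨i, Nat.lt_succ_of_lt i.2⟩)) :=
        ih.comp (measurable_pi_lambda _ fun i => measurable_pi_apply _)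
      exact (B.measurable_update ⟨n, hn⟩).comp (h1.prodMk (measurable_pi_apply _))

theorem measurable_balBefore (B : BankAccountMechanism k) (t : Fin T) :
    Measurable (B.balBefore t) :=
  (B.measurable_bal t t.2.le).comp (measurable_pi_lambda _ fun _ => measurable_pi_apply _)

/-- The direct mechanism that a bank account mechanism induces: the buyer receives
`z_t(bal_t, v_t)` and pays `s_t(bal_t) + q_t(bal_t, v_t)`. -/
noncomputable def toDirect (B : BankAccountMechanism k) : DirectMechanism k where
  alloc t h := B.z t (B.balBefore t h) (h ⟨t, Nat.lt_succ_self _⟩)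
  pay t h := B.s t (B.balBefore t h) + B.q t (B.balBefore t h) (h ⟨t, Nat.lt_succ_self _⟩)
  measurable_alloc t :=
    (B.measurable_z t).comp ((B.measurable_balBefore t).prodMk (measurable_pi_apply _))
  measurable_pay t :=
    ((B.measurable_s t).comp (B.measurable_balBefore t)).add
      ((B.measurable_q t).comp
        ((B.measurable_balBefore t).prodMk (measurable_pi_apply _))).coe_nnreal_real

/-- Utility of the stage mechanism `⟨z, q⟩` at balance `β`, report `v'` and true type `v`. -/
noncomputable def uHat (B : BankAccountMechanism k) (t : Fin T) (β : ℝ≥0) (v' v : Val (k t)) : ℝ :=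
  dot (B.z t β v') v - B.q t β v'

/-- The IC and IR constraints that single out the BAMs among the bank account mechanisms. -/
structure IsBAM (B : BankAccountMechanism k) (F : (t : Fin T) → Measure (Val (k t))) : Prop where
  /-- Every stage mechanism is truthful, at every balance. -/
  stage_ic : ∀ t β v v', B.uHat t β v' v ≤ B.uHat t β v v
  integrable_uHat : ∀ t β, Integrable (fun v => B.uHat t β v v) (F t)
  /-- The buyer is indifferent between all balances. -/
  spend : ∀ t β β', B.s t β - B.s t β' = ∫ v, (B.uHat t β v v - B.uHat t β' v v) ∂(F t)
  /-- Deposits do not exceed the truthful stage utility. -/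
  ir : ∀ t β v, (B.d t β v : ℝ) ≤ B.uHat t β v v

/-- The allocations lie in `{0,1}^(k t)` at every balance. -/
def IsDeterministic (B : BankAccountMechanism k) : Prop :=
  ∀ t β v i, B.z t β v i = 0 ∨ B.z t β v i = 1

end BankAccountMechanism

end Profiles

end DynMech

/-! Revenue is expected welfare (the value of the items sold) minus expected utility, so it suffices
to keep the utility and not to lower the welfare. Let U_n be the conditional mean of the overall
utility of `M`, given the first n types; it serves as the balance. At balance β the new mechanism
picks one history with U_n = β and plays the stage of `M` that follows it, priced so that type a
gains U_{n+1}(a) - U_{n+1}(0). The whole gain is deposited. IC of `M` makes the stage truthful and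
its gains and prices nonnegative. The spend is the mean gain up to a constant, whence the
indifference between balances. By the tower property it equals β - U_{n+1}(0), which is at most β by
IR, and the next balance is exactly U_{n+1}(a). Since balances start at 0 and not at U_0 = Utl(M),
the first spend is lowered by that amount (`offset`).

Replacing a history by another one with the same U_n does not affect utility: U keeps its mean from
stage to stage, and the final balance is the realized utility. The replacement can be made so that
the mean of the expected future welfare does not drop. `exists_measurable_selection` achieves this
by a measurable function of the balance, without randomization, so determinism survives.
`IsIC.exists_representatives` iterates it over the stages. -/

namespace DynMech

/-! ### Measurable selection -/

/-- Uniformization by fixing the seed of a randomized selection: a random variable `X` can be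
replaced by a function of `Y`, without losing expected value or any almost sure relation. -/
theorem exists_measurable_selection {Ω A E : Type*} [MeasurableSpace Ω] [MeasurableSpace A]
    [MeasurableSpace E] [StandardBorelSpace E] [Nonempty E] (P : Measure Ω)
    [IsProbabilityMeasure P] {Y : Ω → A} {X : Ω → E} (hY : Measurable Y) (hX : Measurable X)
    {G : Set (A × E)} (hG : MeasurableSet G) (hGae : ∀ᵐ ω ∂P, (Y ω, X ω) ∈ G)
    {V : E → ℝ} (hV : Measurable V) (hVi : Integrable (fun ω => V (X ω)) P) :
    ∃ r : A → E, Measurable r ∧ (∀ᵐ ω ∂P, (Y ω, r (Y ω)) ∈ G) ∧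
      ∫ ω, V (X ω) ∂P ≤ ∫ ω, V (r (Y ω)) ∂P := by
  have hYX : Measurable fun ω => (Y ω, X ω) := hY.prodMk hX
  set J : Measure (A × E) := P.map fun ω => (Y ω, X ω) with hJ
  have : IsProbabilityMeasure J := Measure.isProbabilityMeasure_map hYX.aemeasurable
  -- The conditional law of `X` given `Y` is that of `f Y θ` with an independent uniform seed θ, so
  -- `(Y, f Y θ)` has the joint law of `(Y, X)`.
  obtain ⟨f, hf, hfκ⟩ :=
    ProbabilityTheory.Kernel.exists_measurable_map_eq_unitInterval J.condKernel
  have hΦ : Measurable fun p : Ω × unitInterval => (Y p.1, f (Y p.1) p.2) :=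
    (hY.comp measurable_fst).prodMk (hf.comp ((hY.comp measurable_fst).prodMk measurable_snd))
  have hfst : J.fst = P.map Y := by
    rw [hJ, Measure.fst_map_prodMk hX]
  have hmp : MeasurePreserving (fun p : Ω × unitInterval => (Y p.1, f (Y p.1) p.2))
      (P.prod volume) J := by
    refine ⟨hΦ, ?_⟩
    rw [← J.disintegrate J.condKernel, hfst]
    ext s hs
    rw [Measure.map_apply hΦ hs, Measure.prod_apply (hΦ hs), Measure.compProd_apply hs,
      lintegral_map (ProbabilityTheory.Kernel.measurable_kernel_prodMk_left hs) hY]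
    refine lintegral_congr fun ω => ?_
    rw [← hfκ (Y ω), Measure.map_apply hf.of_uncurry_left (measurable_prodMk_left hs)]
    rfl
  have hV2 : Measurable fun p : A × E => V p.2 := hV.comp measurable_snd
  have hVJ : Integrable (fun p : A × E => V p.2) J := by
    rw [hJ, integrable_map_measure hV2.aestronglyMeasurable
      hYX.aemeasurable]
    exact hVi
  have hVJint : ∫ p, V p.2 ∂J = ∫ ω, V (X ω) ∂P := by
    rw [hJ, integral_map hYX.aemeasurable hV2.aestronglyMeasurable]
  have hVΦ : Integrable (fun p : Ω × unitInterval => V (f (Y p.1) p.2)) (P.prod volume) :=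
    hmp.integrable_comp_of_integrable hVJ
  have hVΦint : ∫ p : Ω × unitInterval, V (f (Y p.1) p.2) ∂(P.prod volume)
      = ∫ ω, V (X ω) ∂P := by
    rw [← hVJint, ← hmp.map_eq, integral_map hΦ.aemeasurable]
    exact hV2.aestronglyMeasurable
  have hGJ : ∀ᵐ p ∂J, p ∈ G := (ae_map_iff hYX.aemeasurable hG).2 hGae
  have hGΦ : ∀ᵐ p : Ω × unitInterval ∂(P.prod volume), (Y p.1, f (Y p.1) p.2) ∈ G :=
    hmp.quasiMeasurePreserving.ae hGJ
  have hGθ : ∀ᵐ θ : unitInterval, ∀ᵐ ω ∂P, (Y ω, f (Y ω) θ) ∈ G :=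
    Measure.ae_ae_of_ae_prod (Measure.measurePreserving_swap.quasiMeasurePreserving.ae hGΦ)
  -- The mean over all seeds is the mean of `V X`; some seed outside the null set of bad ones
  -- attains at least this mean.
  obtain ⟨θ, hθ, hle⟩ := exists_notMem_null_integral_le hVΦ.integral_prod_right (ae_iff.1 hGθ)
  simp only [Set.mem_ofPred_eq, not_not] at hθ
  refine ⟨fun b => f b θ, hf.of_uncurry_right, hθ, ?_⟩
  rwa [← integral_prod_symm _ hVΦ, hVΦint] at hle

/-! ### Resampling independent types, and conditional means -/

section Resample

variable {T : ℕ} {k : Fin T → ℕ} (F : (t : Fin T) → Measure (Val (k t)))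

/-- The profile with the first `n` types from `v` and the later ones from `w`. -/
def mix (n : ℕ) (v w : Profile k) : Profile k := splice (take v n) w

theorem mix_apply (n : ℕ) (v w : Profile k) (i : Fin T) :
    mix n v w i = if (i : ℕ) < n then v i else w i := by
  by_cases h : (i : ℕ) < n <;> simp [mix, splice, take, h]

theorem mix_zero (v w : Profile k) : mix 0 v w = w := by
  ext1 i; simp [mix_apply]

theorem mix_of_le {n : ℕ} (hn : T ≤ n) (v w : Profile k) : mix n v w = v := by
  ext1 i; simp [mix_apply, i.2.trans_le hn]

/-- Drawing the type of stage `t` along with the future amounts to fixing it as part of the past;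
this links the conditional means at `t` and `t + 1`. -/
theorem mix_update (t : Fin T) (v w : Profile k) (a : Val (k t)) :
    mix t v (Function.update w t a) = mix (t + 1) (Function.update v t a) w := by
  ext1 i
  by_cases hi : i = t
  · subst hi; simp [mix_apply]
  · have : (i : ℕ) ≠ t := fun h => hi (Fin.ext h)
    have h' : (i : ℕ) < t ↔ (i : ℕ) < t + 1 := by omega
    simp [mix_apply, hi, h']

theorem take_mix {n m : ℕ} (h : n ≤ m) (v w : Profile k) : take (mix m v w) n = take v n := by
  ext1 i
  simp [take, mix_apply, i.2.trans_le h]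

theorem take_update_of_le {n : ℕ} {t : Fin T} (h : n ≤ t) (v : Profile k) (a : Val (k t)) :
    take (Function.update v t a) n = take v n := by
  ext1 i
  have hi : (i : Fin T) ≠ t := fun e => by have := i.2; rw [e] at this; omega
  simp [take, hi]

theorem measurable_mix (n : ℕ) :
    Measurable fun p : Profile k × Profile k => mix n p.1 p.2 := by
  refine measurable_pi_lambda _ fun i => ?_
  by_cases h : (i : ℕ) < n
  · simp only [mix_apply, h, if_true]
    exact (measurable_pi_apply i).comp measurable_fst
  · simp only [mix_apply, h, if_false]
    exact (measurable_pi_apply i).comp measurable_snd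

theorem measurable_take (n : ℕ) : Measurable fun v : Profile k => take v n :=
  measurable_pi_lambda _ fun i => measurable_pi_apply (i : Fin T)

/-- The conditional mean of `f`, given the first `n` types. -/
noncomputable def condMean (n : ℕ) (f : Profile k → ℝ) (v : Profile k) : ℝ :=
  ∫ w, f (mix n v w) ∂(Measure.pi F)

variable {F}

theorem condMean_nonneg (n : ℕ) {f : Profile k → ℝ} (hf : ∀ v, 0 ≤ f v) (v : Profile k) :
    0 ≤ condMean F n f v := integral_nonneg fun _ => hf _

theorem condMean_zero (f : Profile k → ℝ) (v : Profile k) :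
    condMean F 0 f v = ∫ w, f w ∂(Measure.pi F) := by
  simp [condMean, mix_zero]

variable [∀ t, IsProbabilityMeasure (F t)]

variable (F) in
-- Independence of the stages: a fresh draw of one coordinate leaves the product law unchanged, as
-- is checked on boxes.
theorem measurePreserving_update_pi (t : Fin T) :
    MeasurePreserving (fun p : Profile k × Val (k t) => Function.update p.1 t p.2)
      ((Measure.pi F).prod (F t)) (Measure.pi F) := by
  refine ⟨measurable_update', (Measure.pi_eq fun s hs => ?_).symm⟩
  rw [Measure.map_apply measurable_update' (MeasurableSet.univ_pi hs)]
  have : (fun p : Profile k × Val (k t) => Function.update p.1 t p.2) ⁻¹' Set.univ.pi s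
      = (Set.univ.pi (Function.update s t Set.univ)) ×ˢ s t := by
    ext ⟨v, a⟩
    simp only [Set.mem_preimage, Set.mem_pi, Set.mem_univ, true_implies, Set.mem_prod]
    constructor
    · intro h
      refine ⟨fun i => ?_, by simpa using h t⟩
      by_cases hi : i = t
      · subst hi; simp
      · simpa [hi] using h i
    · rintro ⟨h, ha⟩ i
      by_cases hi : i = t
      · subst hi; simpa using ha
      · simpa [hi] using h i
  rw [this, Measure.prod_prod, Measure.pi_pi,
    ← Finset.mul_prod_erase _ _ (Finset.mem_univ t),
    ← Finset.mul_prod_erase Finset.univ (fun i => (F i) (s i)) (Finset.mem_univ t)]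
  simp only [Function.update_self, measure_univ, one_mul]
  rw [mul_comm]
  congr 1
  exact Finset.prod_congr rfl fun i hi => by rw [Function.update_of_ne (Finset.ne_of_mem_erase hi)]

/-- By Tonelli, nonnegativity turns finiteness of the iterated integral into integrability, so the
latter need not be assumed. -/
theorem integral_resample (t : Fin T) {g : Profile k → ℝ} (hg : Measurable g) (h0 : ∀ v, 0 ≤ g v)
    (h1 : ∀ v, Integrable (fun a => g (Function.update v t a)) (F t))
    (h2 : Integrable (fun v => ∫ a, g (Function.update v t a) ∂(F t)) (Measure.pi F)) :
    Integrable g (Measure.pi F) ∧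
      ∫ v, g v ∂(Measure.pi F) = ∫ v, ∫ a, g (Function.update v t a) ∂(F t) ∂(Measure.pi F) := by
  have hmp := measurePreserving_update_pi F t
  have hm : Measurable fun p : Profile k × Val (k t) => g (Function.update p.1 t p.2) :=
    hg.comp hmp.measurable
  have hi : Integrable (fun p : Profile k × Val (k t) => g (Function.update p.1 t p.2))
      ((Measure.pi F).prod (F t)) := by
    rw [integrable_prod_iff hm.aestronglyMeasurable]
    refine ⟨.of_forall h1, ?_⟩
    simpa only [Real.norm_eq_abs, abs_of_nonneg (h0 _)] using h2
  refine ⟨(hmp.integrable_comp hg.aestronglyMeasurable).1 hi, ?_⟩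
  rw [← integral_prod _ hi, ← integral_map hmp.aemeasurable hg.aestronglyMeasurable, hmp.map_eq]

theorem integral_resample_symm (t : Fin T) {g : Profile k → ℝ} (hg : Measurable g)
    (h0 : ∀ v, 0 ≤ g v)
    (h1 : ∀ a, Integrable (fun v => g (Function.update v t a)) (Measure.pi F))
    (h2 : Integrable (fun a => ∫ v, g (Function.update v t a) ∂(Measure.pi F)) (F t)) :
    Integrable g (Measure.pi F) ∧
      ∫ v, g v ∂(Measure.pi F) = ∫ a, ∫ v, g (Function.update v t a) ∂(Measure.pi F) ∂(F t) := by
  have hmp := measurePreserving_update_pi F t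
  have hm : Measurable fun p : Profile k × Val (k t) => g (Function.update p.1 t p.2) :=
    hg.comp hmp.measurable
  have hi : Integrable (fun p : Profile k × Val (k t) => g (Function.update p.1 t p.2))
      ((Measure.pi F).prod (F t)) := by
    rw [integrable_prod_iff' hm.aestronglyMeasurable]
    refine ⟨.of_forall h1, ?_⟩
    simpa only [Real.norm_eq_abs, abs_of_nonneg (h0 _)] using h2
  refine ⟨(hmp.integrable_comp hg.aestronglyMeasurable).1 hi, ?_⟩
  rw [← integral_prod_symm _ hi, ← integral_map hmp.aemeasurable hg.aestronglyMeasurable,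
    hmp.map_eq]

theorem measurable_condMean (n : ℕ) {f : Profile k → ℝ} (hf : Measurable f) :
    Measurable (condMean F n f) :=
  (StronglyMeasurable.integral_prod_right'
    (hf.comp (measurable_mix n)).stronglyMeasurable).measurable

theorem condMean_of_le {n : ℕ} (hn : T ≤ n) (f : Profile k → ℝ) (v : Profile k) :
    condMean F n f v = f v := by
  simp [condMean, mix_of_le hn]

/-- The tower property. Integrability at `t` is a conclusion drawn from stage `t + 1`, as backward
induction requires. -/
theorem condMean_step (t : Fin T) {f : Profile k → ℝ} (hf : Measurable f) (h0 : ∀ v, 0 ≤ f v)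
    (v : Profile k)
    (h1 : ∀ a, Integrable (fun w => f (mix (t + 1) (Function.update v t a) w)) (Measure.pi F))
    (h2 : Integrable (fun a => condMean F (t + 1) f (Function.update v t a)) (F t)) :
    Integrable (fun w => f (mix t v w)) (Measure.pi F) ∧
      condMean F t f v = ∫ a, condMean F (t + 1) f (Function.update v t a) ∂(F t) := by
  have hg : Measurable fun w => f (mix t v w) :=
    hf.comp ((measurable_mix (t : ℕ)).comp measurable_prodMk_left)
  have := integral_resample_symm (F := F) t hg (fun w => h0 _)
    (by simpa only [mix_update] using h1) (by simp only [mix_update]; exact h2)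
  simp only [mix_update] at this
  exact this

end Resample

/-! ### Bounds for the value of an allocation -/

section Dot

variable {m : ℕ}

theorem dot_nonneg (x : Alloc m) (v : Val m) : 0 ≤ dot x v :=
  Finset.sum_nonneg fun i _ => mul_nonneg (x i).2.1 (v i).2

theorem dot_le_sum (x : Alloc m) (v : Val m) : dot x v ≤ ∑ i, (v i : ℝ) :=
  Finset.sum_le_sum fun i _ => mul_le_of_le_one_left (v i).2 (x i).2.2

theorem dot_zero (x : Alloc m) : dot x 0 = 0 := by simp [dot]

theorem zero_dot (v : Val m) : dot 0 v = 0 := by simp [dot]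

theorem measurable_dot : Measurable fun p : Alloc m × Val m => dot p.1 p.2 := by
  unfold dot
  refine Finset.measurable_sum _ fun i _ => ?_
  exact (((measurable_pi_apply i).comp measurable_fst).subtype_val).mul
    (((measurable_pi_apply i).comp measurable_snd).coe_nnreal_real)

end Dot

variable {T : ℕ} {k : Fin T → ℕ}

/-! ### Conditional expected utility under IC and IR -/

namespace DirectMechanism

variable (M : DirectMechanism k)

/-- The value of the items that a truthful buyer with types `v` receives at stage `t`. -/
noncomputable def welfare (t : Fin T) (v : Profile k) : ℝ :=
  dot (M.alloc t (take v (t + 1))) (v t)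

theorem welfare_nonneg (t : Fin T) (v : Profile k) : 0 ≤ M.welfare t v := dot_nonneg _ _

theorem welfare_le (t : Fin T) (v : Profile k) : M.welfare t v ≤ ∑ i, (v t i : ℝ) :=
  dot_le_sum _ _

theorem measurable_welfare (t : Fin T) : Measurable (M.welfare t) :=
  measurable_dot.comp
    (((M.measurable_alloc t).comp (measurable_take _)).prodMk (measurable_pi_apply t))

theorem measurable_totalPay : Measurable M.totalPay :=
  Finset.measurable_sum _ fun t _ => (M.measurable_pay t).comp (measurable_take _)

theorem totalUtil_eq (v : Profile k) :
    M.totalUtil v = ∑ t, M.welfare t v - M.totalPay v := by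
  simp [totalUtil, totalPay, stageUtil, welfare]

theorem measurable_totalUtil : Measurable M.totalUtil := by
  simp only [funext M.totalUtil_eq]
  exact (Finset.measurable_sum _ fun t _ => M.measurable_welfare t).sub M.measurable_totalPay

theorem report_truthful (n : ℕ) (v : Profile k) : report truthful n v = v := by
  ext1 i; simp [report, truthful, take]

/-- The utility of a truthful buyer with types `v` in the first `n` stages. -/
noncomputable def pastUtil (n : ℕ) (v : Profile k) : ℝ :=
  ∑ t ∈ Finset.univ.filter (fun t : Fin T => (t : ℕ) < n), M.stageUtil t (take v (t + 1)) (v t)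

theorem pastUtil_succ (t : Fin T) (v : Profile k) :
    M.pastUtil (t + 1) v = M.pastUtil t v + M.stageUtil t (take v (t + 1)) (v t) := by
  have : Finset.univ.filter (fun s : Fin T => (s : ℕ) < t + 1)
      = insert t (Finset.univ.filter (fun s : Fin T => (s : ℕ) < t)) := by
    ext s
    simp only [Finset.mem_filter, Finset.mem_univ, true_and, Finset.mem_insert, Fin.ext_iff]
    omega
  rw [pastUtil, this, Finset.sum_insert (by simp), add_comm, pastUtil]

theorem pastUtil_congr {n : ℕ} {v w : Profile k} (h : ∀ i : Fin T, (i : ℕ) < n → v i = w i) :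
    M.pastUtil n v = M.pastUtil n w := by
  refine Finset.sum_congr rfl fun t ht => ?_
  have ht : (t : ℕ) < n := by simpa using ht
  have h1 : take v (t + 1) = take w (t + 1) := by
    ext1 i
    exact h i (by have := i.2; omega)
  rw [h1, h t ht]

theorem totalUtil_mix (n : ℕ) (v w : Profile k) :
    M.totalUtil (mix n v w) = M.pastUtil n v + M.futureUtil truthful (take v n) w := by
  rw [← M.pastUtil_congr (v := mix n v w) fun i hi => by simp [mix_apply, hi],
    totalUtil, ← Finset.sum_filter_add_sum_filter_not _ (fun t : Fin T => (t : ℕ) < n), pastUtil,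
    futureUtil]
  simp only [not_lt, report_truthful]
  congr 1
  refine Finset.sum_congr rfl fun t ht => ?_
  have ht : ¬ (t : ℕ) < n := by simpa using ht
  rw [mix_apply, if_neg ht]
  rfl

variable {F : (t : Fin T) → Measure (Val (k t))} [∀ t, IsProbabilityMeasure (F t)]

theorem integrable_futureUtil_truthful {n : ℕ} {v : Profile k}
    (h : Integrable (fun w => M.totalUtil (mix n v w)) (Measure.pi F)) :
    Integrable (M.futureUtil truthful (take v n)) (Measure.pi F) := by
  simp only [totalUtil_mix] at h
  exact (integrable_add_iff_integrable_right' (integrable_const _)).1 h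

theorem condMean_totalUtil {n : ℕ} {v : Profile k}
    (h : Integrable (fun w => M.totalUtil (mix n v w)) (Measure.pi F)) :
    condMean F n M.totalUtil v = M.pastUtil n v + M.expUtil F truthful (take v n) := by
  simp only [condMean, totalUtil_mix, expUtil]
  rw [integral_add (integrable_const _) (M.integrable_futureUtil_truthful h)]
  simp

variable {M}

/-- Incentive compatibility of a single report, in terms of the conditional means of the overall
utility. -/
theorem IsIC.condMean_totalUtil_le (hIC : M.IsIC F) (t : Fin T) (v : Profile k) (a b : Val (k t))
    (h : ∀ c, Integrable (fun w => M.totalUtil (mix (t + 1) (Function.update v t c) w))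
      (Measure.pi F)) :
    condMean F (t + 1) M.totalUtil (Function.update v t a)
        + dot (M.alloc t (take (Function.update v t a) (t + 1))) b
        - dot (M.alloc t (take (Function.update v t a) (t + 1))) a
      ≤ condMean F (t + 1) M.totalUtil (Function.update v t b) := by
  -- The true type is `b`, the report is `a`, and bidding is truthful afterwards. The past utility
  -- is common to both sides and can be added.
  have key := hIC t (Function.update v t b) a truthful (fun τ => measurable_pi_apply _)
  simp only [Function.update_idem, Function.update_self] at key
  have key := key (M.integrable_futureUtil_truthful (h a))
  have hp : M.pastUtil t (Function.update v t a) = M.pastUtil t (Function.update v t b) := by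
    refine M.pastUtil_congr fun i hi => ?_
    have : i ≠ t := fun e => by simp [e] at hi
    simp [this]
  rw [M.condMean_totalUtil (h a), M.condMean_totalUtil (h b), M.pastUtil_succ, M.pastUtil_succ,
    hp]
  simp only [stageUtil, Function.update_self] at key ⊢
  linarith

/-- The conditional mean of the overall utility exceeds that after a zero type by at most the sum
of the types of the current stage. -/
theorem IsIC.condMean_totalUtil_le_zero_add (hIC : M.IsIC F) (t : Fin T) (v : Profile k)
    (a : Val (k t))
    (h : ∀ c, Integrable (fun w => M.totalUtil (mix (t + 1) (Function.update v t c) w))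
      (Measure.pi F)) :
    condMean F (t + 1) M.totalUtil (Function.update v t a)
      ≤ condMean F (t + 1) M.totalUtil (Function.update v t 0) + ∑ i, (a i : ℝ) := by
  have h1 := hIC.condMean_totalUtil_le t v a 0 h
  rw [dot_zero] at h1
  linarith [dot_le_sum (M.alloc t (take (Function.update v t a) (t + 1))) a]

/-- A type-zero buyer could report `a`, so the conditional mean is dominated by a constant plus the
sum of the entries of `a`, which is integrable. -/
theorem IsIC.integrable_condMean_update (hIC : M.IsIC F) (hIR : M.IsIR)
    (hF : ∀ (t : Fin T) (i : Fin (k t)), Integrable (fun v : Val (k t) => (v i : ℝ)) (F t))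
    (t : Fin T) (v : Profile k)
    (h : ∀ c, Integrable (fun w => M.totalUtil (mix (t + 1) (Function.update v t c) w))
      (Measure.pi F)) :
    Integrable (fun a => condMean F (t + 1) M.totalUtil (Function.update v t a)) (F t) := by
  have hg : Integrable (fun a : Val (k t) =>
      condMean F (t + 1) M.totalUtil (Function.update v t 0) + ∑ i, (a i : ℝ)) (F t) :=
    (integrable_const _).add (integrable_finsetSum _ fun i _ => hF t i)
  refine hg.mono' ?_ (.of_forall fun a => ?_)
  · exact ((measurable_condMean _ M.measurable_totalUtil).comp
      (measurable_update v)).aestronglyMeasurable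
  · rw [Real.norm_eq_abs, abs_of_nonneg (condMean_nonneg _ hIR _)]
    exact hIC.condMean_totalUtil_le_zero_add t v a h

/-- Truthful bidding has a finite expected utility after every history. -/
theorem IsIC.integrable_totalUtil_mix (hIC : M.IsIC F) (hIR : M.IsIR)
    (hF : ∀ (t : Fin T) (i : Fin (k t)), Integrable (fun v : Val (k t) => (v i : ℝ)) (F t))
    (n : ℕ) (v : Profile k) :
    Integrable (fun w => M.totalUtil (mix n v w)) (Measure.pi F) := by
  -- Backward induction from the end, where nothing is random. IC at a stage presupposes
  -- integrability only after that stage, so there is no circularity.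
  induction hm : T - n generalizing n v with
  | zero => simp [mix_of_le (Nat.sub_eq_zero_iff_le.1 hm)]
  | succ m ih =>
    have ih' := fun v => ih (n + 1) v (by omega)
    exact (condMean_step ⟨n, by omega⟩ M.measurable_totalUtil hIR v (fun a => ih' _)
      (hIC.integrable_condMean_update hIR hF ⟨n, by omega⟩ v fun c => ih' _)).1

theorem IsIC.condMean_totalUtil_eq_integral (hIC : M.IsIC F) (hIR : M.IsIR)
    (hF : ∀ (t : Fin T) (i : Fin (k t)), Integrable (fun v : Val (k t) => (v i : ℝ)) (F t))
    (t : Fin T) (v : Profile k) :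
    condMean F t M.totalUtil v
      = ∫ a, condMean F (t + 1) M.totalUtil (Function.update v t a) ∂(F t) :=
  (condMean_step t M.measurable_totalUtil hIR v
    (fun _ => hIC.integrable_totalUtil_mix hIR hF _ _)
    (hIC.integrable_condMean_update hIR hF t v
      fun _ => hIC.integrable_totalUtil_mix hIR hF _ _)).2

theorem integrable_sum_val
    (hF : ∀ (t : Fin T) (i : Fin (k t)), Integrable (fun v : Val (k t) => (v i : ℝ)) (F t)) :
    Integrable (fun v : Profile k => ∑ t, ∑ i, (v t i : ℝ)) (Measure.pi F) :=
  integrable_finsetSum _ fun t _ => integrable_finsetSum _ fun i _ =>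
    integrable_comp_eval (μ := F) (i := t) (f := fun a : Val (k t) => (a i : ℝ)) (hF t i)

variable (M) in
theorem integrable_welfare
    (hF : ∀ (t : Fin T) (i : Fin (k t)), Integrable (fun v : Val (k t) => (v i : ℝ)) (F t))
    (t : Fin T) : Integrable (M.welfare t) (Measure.pi F) := by
  refine Integrable.mono' (g := fun v => ∑ i, (v t i : ℝ))
    (integrable_finsetSum _ fun i _ =>
    integrable_comp_eval (μ := F) (i := t) (f := fun a : Val (k t) => (a i : ℝ)) (hF t i))
    (M.measurable_welfare t).aestronglyMeasurable (.of_forall fun v => ?_)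
  rw [Real.norm_eq_abs, abs_of_nonneg (M.welfare_nonneg t v)]
  exact M.welfare_le t v

/-- Payments are welfare minus utility, and welfare is always integrable; comparing revenues at
equal utility thus means comparing welfare. -/
theorem hasFiniteExpectations_of_integrable_totalUtil
    (hF : ∀ (t : Fin T) (i : Fin (k t)), Integrable (fun v : Val (k t) => (v i : ℝ)) (F t))
    (h : Integrable M.totalUtil (Measure.pi F)) :
    M.HasFiniteExpectations F ∧
      M.rev F = ∑ t, ∫ v, M.welfare t v ∂(Measure.pi F) - M.utl F := by
  have hw : Integrable (fun v => ∑ t, M.welfare t v) (Measure.pi F) :=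
    integrable_finsetSum _ fun t _ => M.integrable_welfare hF t
  have e : M.totalPay = fun v => ∑ t, M.welfare t v - M.totalUtil v := by
    funext v; rw [totalUtil_eq]; ring
  refine ⟨⟨?_, h⟩, ?_⟩
  · rw [e]; exact hw.sub h
  · rw [rev, e, integral_sub hw h, integral_finsetSum _ fun t _ => M.integrable_welfare hF t, utl]

end DirectMechanism

/-! ### Expected future welfare -/

namespace DirectMechanism

variable (M : DirectMechanism k)

theorem welfare_mix {t : Fin T} {n : ℕ} (h : (t : ℕ) < n) (v w : Profile k) :
    M.welfare t (mix n v w) = M.welfare t v := by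
  rw [welfare, welfare, take_mix (Nat.succ_le_of_lt h), mix_apply, if_pos h]

/-- The value of the items that a truthful buyer receives after the first `n` stages. -/
noncomputable def futureWelfare (n : ℕ) (v : Profile k) : ℝ :=
  ∑ t ∈ Finset.univ.filter (fun t : Fin T => n ≤ (t : ℕ)), M.welfare t v

theorem measurable_futureWelfare (n : ℕ) : Measurable (M.futureWelfare n) :=
  Finset.measurable_sum _ fun t _ => M.measurable_welfare t

theorem futureWelfare_nonneg (n : ℕ) (v : Profile k) : 0 ≤ M.futureWelfare n v :=
  Finset.sum_nonneg fun t _ => M.welfare_nonneg t v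

theorem futureWelfare_eq_add (t : Fin T) (v : Profile k) :
    M.futureWelfare t v = M.welfare t v + M.futureWelfare (t + 1) v := by
  have : Finset.univ.filter (fun s : Fin T => (t : ℕ) ≤ s)
      = insert t (Finset.univ.filter (fun s : Fin T => (t : ℕ) + 1 ≤ s)) := by
    ext s
    simp only [Finset.mem_filter, Finset.mem_univ, true_and, Finset.mem_insert, Fin.ext_iff]
    omega
  rw [futureWelfare, this, Finset.sum_insert (by simp), futureWelfare]

theorem futureWelfare_mix_le (n : ℕ) (v w : Profile k) :
    M.futureWelfare n (mix n v w) ≤ ∑ t, ∑ i, (w t i : ℝ) := by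
  refine (Finset.sum_le_sum fun t ht => ?_).trans
    (Finset.sum_le_univ_sum_of_nonneg fun t => Finset.sum_nonneg fun i _ => (w t i).2)
  have ht : ¬ (t : ℕ) < n := by simpa using ht
  simpa [mix_apply, ht] using M.welfare_le t (mix n v w)

variable {F : (t : Fin T) → Measure (Val (k t))}

variable (F) in
/-- The conditional mean of the future welfare, given the first `n` types. -/
noncomputable def expWelfare (n : ℕ) (v : Profile k) : ℝ := condMean F n (M.futureWelfare n) v

theorem expWelfare_nonneg (n : ℕ) (v : Profile k) : 0 ≤ M.expWelfare F n v :=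
  condMean_nonneg n (M.futureWelfare_nonneg n) v

theorem integrable_welfare_update
    (hF : ∀ (t : Fin T) (i : Fin (k t)), Integrable (fun v : Val (k t) => (v i : ℝ)) (F t))
    (t : Fin T) (v : Profile k) :
    Integrable (fun a => M.welfare t (Function.update v t a)) (F t) := by
  refine Integrable.mono' (g := fun a => ∑ i, (a i : ℝ)) (integrable_finsetSum _ fun i _ => hF t i)
    ((M.measurable_welfare t).comp (measurable_update v)).aestronglyMeasurable
    (.of_forall fun a => ?_)
  rw [Real.norm_eq_abs, abs_of_nonneg (M.welfare_nonneg _ _)]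
  simpa using M.welfare_le t (Function.update v t a)

variable [∀ t, IsProbabilityMeasure (F t)]

theorem measurable_expWelfare (n : ℕ) : Measurable (M.expWelfare F n) :=
  measurable_condMean n (M.measurable_futureWelfare n)

theorem expWelfare_of_le {n : ℕ} (h : T ≤ n) (v : Profile k) : M.expWelfare F n v = 0 := by
  rw [expWelfare, condMean_of_le h, futureWelfare, Finset.filter_false_of_mem, Finset.sum_empty]
  intro t _
  have := t.2
  omega

variable (hF : ∀ (t : Fin T) (i : Fin (k t)), Integrable (fun v : Val (k t) => (v i : ℝ)) (F t))
include hF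

theorem expWelfare_zero (v : Profile k) :
    M.expWelfare F 0 v = ∑ t, ∫ w, M.welfare t w ∂(Measure.pi F) := by
  rw [expWelfare, condMean_zero, ← integral_finsetSum _ fun t _ => M.integrable_welfare hF t]
  simp [futureWelfare]

theorem integrable_futureWelfare_mix (n : ℕ) (v : Profile k) :
    Integrable (fun w => M.futureWelfare n (mix n v w)) (Measure.pi F) := by
  refine (integrable_sum_val hF).mono'
    ((M.measurable_futureWelfare n).comp
      ((measurable_mix n).comp measurable_prodMk_left)).aestronglyMeasurable
    (.of_forall fun w => ?_)
  rw [Real.norm_eq_abs, abs_of_nonneg (M.futureWelfare_nonneg _ _)]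
  exact M.futureWelfare_mix_le n v w

/-- The bound does not depend on the history, so expected future welfare stays integrable along any
random choice of histories. -/
theorem expWelfare_le (n : ℕ) (v : Profile k) :
    M.expWelfare F n v ≤ ∫ w, ∑ t, ∑ i, (w t i : ℝ) ∂(Measure.pi F) :=
  integral_mono (M.integrable_futureWelfare_mix hF n v) (integrable_sum_val hF)
    (M.futureWelfare_mix_le n v)

theorem integrable_expWelfare_comp {Ω : Type*} [MeasurableSpace Ω] {P : Measure Ω}
    [IsFiniteMeasure P] (n : ℕ) {X : Ω → Profile k} (hX : Measurable X) :
    Integrable (fun ω => M.expWelfare F n (X ω)) P := by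
  refine (integrable_const (∫ w : Profile k, ∑ t, ∑ i, (w t i : ℝ) ∂(Measure.pi F))).mono'
    ((M.measurable_expWelfare n).comp hX).aestronglyMeasurable (.of_forall fun ω => ?_)
  rw [Real.norm_eq_abs, abs_of_nonneg (M.expWelfare_nonneg _ _)]
  exact M.expWelfare_le hF n _

theorem expWelfare_eq_integral (t : Fin T) (v : Profile k) :
    M.expWelfare F t v = ∫ a, (M.welfare t (Function.update v t a)
      + M.expWelfare F (t + 1) (Function.update v t a)) ∂(F t) := by
  have e : ∀ u w : Profile k, M.futureWelfare t (mix (t + 1) u w)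
      = M.welfare t u + M.futureWelfare (t + 1) (mix (t + 1) u w) := fun u w => by
    rw [futureWelfare_eq_add, M.welfare_mix (Nat.lt_succ_self _)]
  have e' : ∀ u, condMean F (t + 1) (M.futureWelfare t) u
      = M.welfare t u + M.expWelfare F (t + 1) u := fun u => by
    simp only [condMean, e, expWelfare]
    rw [integral_add (integrable_const _) (M.integrable_futureWelfare_mix hF _ u)]
    simp
  rw [expWelfare, (condMean_step t (M.measurable_futureWelfare t) (M.futureWelfare_nonneg t) v
    _ _).2]
  · simp only [e']
  · intro a
    simp only [e]
    exact (integrable_const _).add (M.integrable_futureWelfare_mix hF _ _)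
  · simp only [e']
    exact (M.integrable_welfare_update hF t v).add
      (M.integrable_expWelfare_comp hF _ (measurable_update v))

end DirectMechanism

/-! ### Balances and realized utility -/

namespace BankAccountMechanism

variable (B : BankAccountMechanism k)

theorem bal_succ_take (t : Fin T) (v : Profile k) :
    B.bal (t + 1) t.2 (take v (t + 1)) = B.update t (B.bal t t.2.le (take v t)) (v t) := rfl

theorem bal_congr {B C : BankAccountMechanism k} {n : ℕ} (hn : n ≤ T)
    (h : ∀ t : Fin T, (t : ℕ) < n → B.update t = C.update t) (v : Profile k) :
    B.bal n hn (take v n) = C.bal n hn (take v n) := by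
  induction n with
  | zero => rfl
  | succ n ih =>
    have := ih (Nat.le_of_succ_le hn) fun t ht => h t (Nat.lt_succ_of_lt ht)
    rw [bal_succ_take B ⟨n, hn⟩, bal_succ_take C ⟨n, hn⟩, h _ (Nat.lt_succ_self n)]
    exact congrArg (fun β => C.update ⟨n, hn⟩ β (v ⟨n, hn⟩)) this

theorem welfare_toDirect (t : Fin T) (v : Profile k) :
    B.toDirect.welfare t v = dot (B.z t (B.bal t t.2.le (take v t)) (v t)) (v t) := rfl

/-- If the whole stage utility is deposited, then the balance is the utility so far. -/
theorem pastUtil_toDirect (hd : ∀ t β v, (B.d t β v : ℝ) = B.uHat t β v v) {n : ℕ} (hn : n ≤ T)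
    (v : Profile k) : B.toDirect.pastUtil n v = B.bal n hn (take v n) := by
  induction n with
  | zero => simp [DirectMechanism.pastUtil, bal]
  | succ n ih =>
    have e : (B.bal (n + 1) hn (take v (n + 1)) : ℝ)
        = B.bal n (Nat.le_of_succ_le hn) (take v n)
          - B.s ⟨n, hn⟩ (B.bal n (Nat.le_of_succ_le hn) (take v n))
          + B.d ⟨n, hn⟩ (B.bal n (Nat.le_of_succ_le hn) (take v n)) (v ⟨n, hn⟩) := rfl
    have e2 : B.toDirect.stageUtil ⟨n, hn⟩ (take v (n + 1)) (v ⟨n, hn⟩)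
        = dot (B.z ⟨n, hn⟩ (B.bal n (Nat.le_of_succ_le hn) (take v n)) (v ⟨n, hn⟩)) (v ⟨n, hn⟩)
          - (B.s ⟨n, hn⟩ (B.bal n (Nat.le_of_succ_le hn) (take v n))
            + B.q ⟨n, hn⟩ (B.bal n (Nat.le_of_succ_le hn) (take v n)) (v ⟨n, hn⟩)) := rfl
    rw [B.toDirect.pastUtil_succ ⟨n, hn⟩ v, ih (Nat.le_of_succ_le hn), e2, e, hd, uHat]
    ring

theorem totalUtil_toDirect (hd : ∀ t β v, (B.d t β v : ℝ) = B.uHat t β v v) (v : Profile k) :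
    B.toDirect.totalUtil v = B.bal T le_rfl (take v T) := by
  rw [← B.pastUtil_toDirect hd le_rfl v, DirectMechanism.pastUtil,
    Finset.filter_true_of_mem fun t _ => t.2]
  rfl

end BankAccountMechanism

/-! ### The bank account mechanism built from representatives -/

namespace DirectMechanism

variable (M : DirectMechanism k) (F : (t : Fin T) → Measure (Val (k t)))

/-- The part of the promised utility that is not kept in the bank account. It is granted at once. -/
noncomputable def offset (n : ℕ) : ℝ := if n = 0 then M.utl F else 0

/-- The balance `β` after `n` stages stands for the first `n` types of `x`. -/
def Represents (n : ℕ) (β : ℝ≥0) (x : Profile k) : Prop :=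
  (β : ℝ) + M.offset F n = condMean F n M.totalUtil x

open Classical in
/-- The stage utility of the stage mechanism at balance `β`, if `ρ` selects representatives. -/
noncomputable def stageGain (t : Fin T) (ρ : ℝ≥0 → Profile k) (β : ℝ≥0) (a : Val (k t)) : ℝ :=
  if M.Represents F t β (ρ β) then
    condMean F (t + 1) M.totalUtil (Function.update (ρ β) t a)
      - condMean F (t + 1) M.totalUtil (Function.update (ρ β) t 0)
  else 0

open Classical in
/-- The allocation of the stage mechanism at balance `β`, if `ρ` selects representatives. -/
noncomputable def stageAlloc (t : Fin T) (ρ : ℝ≥0 → Profile k) (β : ℝ≥0) (a : Val (k t)) :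
    Alloc (k t) :=
  if M.Represents F t β (ρ β) then M.alloc t (take (Function.update (ρ β) t a) (t + 1)) else 0

/-- The amount spent at balance `β`, if `ρ` selects representatives. -/
noncomputable def stageSpend (t : Fin T) (ρ : ℝ≥0 → Profile k) (β : ℝ≥0) : ℝ :=
  ∫ a, M.stageGain F t ρ β a ∂(F t) - M.offset F t

theorem stageGain_zero (t : Fin T) (ρ : ℝ≥0 → Profile k) (β : ℝ≥0) :
    M.stageGain F t ρ β 0 = 0 := by
  simp [stageGain]

variable {M} in
theorem IsIR.offset_nonneg (hIR : M.IsIR) (n : ℕ) : 0 ≤ M.offset F n := by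
  unfold offset
  split_ifs
  · exact integral_nonneg hIR
  · exact le_rfl

variable {F} [∀ t, IsProbabilityMeasure (F t)]

theorem measurableSet_represents (n : ℕ) :
    MeasurableSet {p : ℝ≥0 × Profile k | M.Represents F n p.1 p.2} :=
  measurableSet_eq_fun (measurable_fst.coe_nnreal_real.add_const _)
    ((measurable_condMean n M.measurable_totalUtil).comp measurable_snd)

theorem measurable_stageGain (t : Fin T) {ρ : ℝ≥0 → Profile k} (hρ : Measurable ρ) :
    Measurable (Function.uncurry (M.stageGain F t ρ)) := by
  have hm := measurable_condMean (F := F) (t + 1) M.measurable_totalUtil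
  have hu : Measurable fun p : ℝ≥0 × Val (k t) => Function.update (ρ p.1) t p.2 :=
    measurable_update'.comp ((hρ.comp measurable_fst).prodMk measurable_snd)
  have hu0 : Measurable fun p : ℝ≥0 × Val (k t) => Function.update (ρ p.1) t 0 :=
    measurable_update'.comp ((hρ.comp measurable_fst).prodMk measurable_const)
  exact Measurable.ite ((measurable_fst.prodMk (hρ.comp measurable_fst))
    (M.measurableSet_represents (F := F) t)) ((hm.comp hu).sub (hm.comp hu0)) measurable_const

theorem measurable_stageAlloc (t : Fin T) {ρ : ℝ≥0 → Profile k} (hρ : Measurable ρ) :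
    Measurable (Function.uncurry (M.stageAlloc F t ρ)) := by
  have hu : Measurable fun p : ℝ≥0 × Val (k t) => Function.update (ρ p.1) t p.2 :=
    measurable_update'.comp ((hρ.comp measurable_fst).prodMk measurable_snd)
  exact Measurable.ite ((measurable_fst.prodMk (hρ.comp measurable_fst))
    (M.measurableSet_represents (F := F) t))
    ((M.measurable_alloc t).comp ((measurable_take _).comp hu)) measurable_const

theorem measurable_stageSpend (t : Fin T) {ρ : ℝ≥0 → Profile k} (hρ : Measurable ρ) :
    Measurable (M.stageSpend F t ρ) :=
  ((M.measurable_stageGain t hρ).stronglyMeasurable.integral_prod_right).measurable.sub_const _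

variable {M}
variable (hIC : M.IsIC F) (hIR : M.IsIR)
  (hF : ∀ (t : Fin T) (i : Fin (k t)), Integrable (fun v : Val (k t) => (v i : ℝ)) (F t))
include hIC hIR hF

/-- IC of `M` at the representative, shifted by the constant that belongs to type zero. Without a
representative the stage sells nothing. -/
theorem IsIC.stageGain_ic (t : Fin T) (ρ : ℝ≥0 → Profile k) (β : ℝ≥0) (a b : Val (k t)) :
    M.stageGain F t ρ β a + dot (M.stageAlloc F t ρ β a) b - dot (M.stageAlloc F t ρ β a) a
      ≤ M.stageGain F t ρ β b := by
  unfold stageGain stageAlloc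
  split_ifs
  · have := hIC.condMean_totalUtil_le t (ρ β) a b
      fun _ => hIC.integrable_totalUtil_mix hIR hF _ _
    linarith
  · simp [zero_dot]

/-- Type `a` may report zero. -/
theorem IsIC.stageGain_nonneg (t : Fin T) (ρ : ℝ≥0 → Profile k) (β : ℝ≥0) (a : Val (k t)) :
    0 ≤ M.stageGain F t ρ β a := by
  have := hIC.stageGain_ic hIR hF t ρ β 0 a
  rw [stageGain_zero, dot_zero] at this
  linarith [dot_nonneg (M.stageAlloc F t ρ β 0) a]

/-- Type zero may report `a`; hence the stage price is nonnegative. -/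
theorem IsIC.stageGain_le_dot (t : Fin T) (ρ : ℝ≥0 → Profile k) (β : ℝ≥0) (a : Val (k t)) :
    M.stageGain F t ρ β a ≤ dot (M.stageAlloc F t ρ β a) a := by
  have := hIC.stageGain_ic hIR hF t ρ β a 0
  rw [stageGain_zero, dot_zero] at this
  linarith

theorem IsIC.integrable_stageGain (t : Fin T) {ρ : ℝ≥0 → Profile k} (hρ : Measurable ρ)
    (β : ℝ≥0) : Integrable (M.stageGain F t ρ β) (F t) := by
  refine Integrable.mono' (g := fun a => ∑ i, (a i : ℝ)) (integrable_finsetSum _ fun i _ => hF t i)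
    ((M.measurable_stageGain t hρ).of_uncurry_left).aestronglyMeasurable
    (.of_forall fun a => ?_)
  rw [Real.norm_eq_abs, abs_of_nonneg (hIC.stageGain_nonneg hIR hF t ρ β a)]
  exact (hIC.stageGain_le_dot hIR hF t ρ β a).trans (dot_le_sum _ _)

/-- By the tower property the mean of the first term of the gain is the conditional mean at `t`,
that is, balance plus offset. -/
theorem IsIC.stageSpend_of_represents (t : Fin T) {ρ : ℝ≥0 → Profile k} {β : ℝ≥0}
    (h : M.Represents F t β (ρ β)) :
    M.stageSpend F t ρ β = β - condMean F (t + 1) M.totalUtil (Function.update (ρ β) t 0) := by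
  have hi := hIC.integrable_condMean_update hIR hF t (ρ β)
    fun _ => hIC.integrable_totalUtil_mix hIR hF _ _
  simp only [stageSpend, stageGain, if_pos h]
  rw [integral_sub hi (integrable_const _), ← hIC.condMean_totalUtil_eq_integral hIR hF t (ρ β),
    ← h]
  simp only [integral_const, probReal_univ, one_smul]
  ring

theorem IsIC.stageSpend_le (t : Fin T) (ρ : ℝ≥0 → Profile k) (β : ℝ≥0) :
    M.stageSpend F t ρ β ≤ β := by
  by_cases h : M.Represents F t β (ρ β)
  · rw [hIC.stageSpend_of_represents hIR hF t h]
    linarith [condMean_nonneg (F := F) (t + 1) hIR (Function.update (ρ β) t 0)]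
  · simp only [stageSpend, stageGain, if_neg h, integral_zero]
    linarith [hIR.offset_nonneg F t, β.2]

/-- The bank account mechanism whose stage mechanism at balance `β` is the one that `M` uses after
the history selected by `r`; the whole stage utility is deposited. -/
noncomputable def bankAccount (r : Fin T → ℝ≥0 → Profile k) (hr : ∀ t, Measurable (r t)) :
    BankAccountMechanism k where
  z t := M.stageAlloc F t (r t)
  -- Neither this truncation at zero nor the one in `d` ever takes effect, by
  -- `IsIC.stageGain_le_dot` and `IsIC.stageGain_nonneg`.
  q t β a := (dot (M.stageAlloc F t (r t) β a) a - M.stageGain F t (r t) β a).toNNReal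
  d t β a := (M.stageGain F t (r t) β a).toNNReal
  s t := M.stageSpend F t (r t)
  s_le t β := hIC.stageSpend_le hIR hF t (r t) β
  measurable_z t := M.measurable_stageAlloc t (hr t)
  measurable_q t :=
    ((measurable_dot.comp ((M.measurable_stageAlloc t (hr t)).prodMk measurable_snd)).sub
      (M.measurable_stageGain t (hr t))).real_toNNReal
  measurable_d t := (M.measurable_stageGain t (hr t)).real_toNNReal
  measurable_s t := M.measurable_stageSpend t (hr t)

section BankAccount

variable (r : Fin T → ℝ≥0 → Profile k) (hr : ∀ t, Measurable (r t))

theorem bankAccount_uHat (t : Fin T) (β : ℝ≥0) (a b : Val (k t)) :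
    (bankAccount hIC hIR hF r hr).uHat t β a b
      = M.stageGain F t (r t) β a + dot (M.stageAlloc F t (r t) β a) b
        - dot (M.stageAlloc F t (r t) β a) a := by
  have := hIC.stageGain_le_dot hIR hF t (r t) β a
  simp only [BankAccountMechanism.uHat, bankAccount]
  rw [Real.coe_toNNReal _ (by linarith)]
  ring

theorem bankAccount_uHat_self (t : Fin T) (β : ℝ≥0) (a : Val (k t)) :
    (bankAccount hIC hIR hF r hr).uHat t β a a = M.stageGain F t (r t) β a := by
  rw [bankAccount_uHat]; ring

theorem bankAccount_z (t : Fin T) (β : ℝ≥0) (a : Val (k t)) :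
    (bankAccount hIC hIR hF r hr).z t β a = M.stageAlloc F t (r t) β a := rfl

theorem bankAccount_d (t : Fin T) (β : ℝ≥0) (a : Val (k t)) :
    ((bankAccount hIC hIR hF r hr).d t β a : ℝ) = M.stageGain F t (r t) β a :=
  Real.coe_toNNReal _ (hIC.stageGain_nonneg hIR hF t (r t) β a)

/-- The spend identity holds at all balances, reachable or not, since the offset is independent of
the balance and cancels. -/
theorem isBAM_bankAccount : (bankAccount hIC hIR hF r hr).IsBAM F where
  stage_ic t β v v' := by
    rw [bankAccount_uHat_self, bankAccount_uHat]
    exact hIC.stageGain_ic hIR hF t (r t) β v' v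
  integrable_uHat t β := by
    simp only [bankAccount_uHat_self]
    exact hIC.integrable_stageGain hIR hF t (hr t) β
  spend t β β' := by
    simp only [bankAccount_uHat_self]
    rw [integral_sub (hIC.integrable_stageGain hIR hF t (hr t) β)
      (hIC.integrable_stageGain hIR hF t (hr t) β')]
    simp [bankAccount, stageSpend]
  ir t β v := by
    rw [bankAccount_uHat_self, bankAccount_d]

theorem isDeterministic_bankAccount (hM : M.IsDeterministic) :
    (bankAccount hIC hIR hF r hr).IsDeterministic := by
  intro t β a i
  simp only [bankAccount, stageAlloc]
  split_ifs
  · exact hM _ _ _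
  · exact Or.inl rfl

/-- Spending leaves the conditional mean for type zero, and the deposit raises it to that for type
`a`. From the first stage on the offset is zero. -/
theorem bankAccount_update_of_represents (t : Fin T) {β : ℝ≥0}
    (h : M.Represents F t β (r t β)) (a : Val (k t)) :
    M.Represents F (t + 1) ((bankAccount hIC hIR hF r hr).update t β a)
      (Function.update (r t β) t a) := by
  have e : ((bankAccount hIC hIR hF r hr).update t β a : ℝ)
      = β - M.stageSpend F t (r t) β + (bankAccount hIC hIR hF r hr).d t β a := rfl
  rw [Represents, e, bankAccount_d, hIC.stageSpend_of_represents hIR hF t h, stageGain, if_pos h]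
  simp [offset]

theorem bankAccount_welfare_of_represents (t : Fin T) (v : Profile k)
    (h : M.Represents F t ((bankAccount hIC hIR hF r hr).bal t t.2.le (take v t))
      (r t ((bankAccount hIC hIR hF r hr).bal t t.2.le (take v t)))) :
    (bankAccount hIC hIR hF r hr).toDirect.welfare t v
      = M.welfare t (Function.update
          (r t ((bankAccount hIC hIR hF r hr).bal t t.2.le (take v t))) t (v t)) := by
  rw [BankAccountMechanism.welfare_toDirect, welfare, Function.update_self, bankAccount_z,
    stageAlloc, if_pos h]

end BankAccount

end DirectMechanism

/-! ### Selecting representatives stage by stage -/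

namespace DirectMechanism

variable {M : DirectMechanism k} {F : (t : Fin T) → Measure (Val (k t))}
  [∀ t, IsProbabilityMeasure (F t)]

/-- As `Z` ignores the type of stage `t`, that type is a fresh draw after the history `Z v`, and the
recursion for `expWelfare` can be averaged. -/
theorem integral_expWelfare_stage
    (hF : ∀ (t : Fin T) (i : Fin (k t)), Integrable (fun v : Val (k t) => (v i : ℝ)) (F t))
    (t : Fin T) {Z : Profile k → Profile k} (hZ : Measurable Z)
    (hZt : ∀ v a, Z (Function.update v t a) = Z v) :
    ∫ v, M.expWelfare F t (Z v) ∂(Measure.pi F)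
      = ∫ v, M.welfare t (Function.update (Z v) t (v t)) ∂(Measure.pi F)
        + ∫ v, M.expWelfare F (t + 1) (Function.update (Z v) t (v t)) ∂(Measure.pi F) := by
  have hX : Measurable fun v : Profile k => Function.update (Z v) t (v t) :=
    measurable_update'.comp (hZ.prodMk (measurable_pi_apply t))
  have hw : Integrable (fun v => M.welfare t (Function.update (Z v) t (v t))) (Measure.pi F) := by
    refine Integrable.mono' (g := fun v => ∑ i, (v t i : ℝ))
      (integrable_finsetSum _ fun i _ =>
        integrable_comp_eval (μ := F) (i := t) (f := fun a : Val (k t) => (a i : ℝ)) (hF t i))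
      ((M.measurable_welfare t).comp hX).aestronglyMeasurable (.of_forall fun v => ?_)
    rw [Real.norm_eq_abs, abs_of_nonneg (M.welfare_nonneg _ _)]
    simpa using M.welfare_le t (Function.update (Z v) t (v t))
  rw [← integral_add hw (M.integrable_expWelfare_comp hF _ hX),
    (integral_resample (F := F) t (g := fun v => M.welfare t (Function.update (Z v) t (v t))
      + M.expWelfare F (t + 1) (Function.update (Z v) t (v t))) _ _ _ _).2]
  · simp only [hZt, Function.update_self, ← M.expWelfare_eq_integral hF]
  · exact ((M.measurable_welfare t).comp hX).add ((M.measurable_expWelfare _).comp hX)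
  · exact fun v => add_nonneg (M.welfare_nonneg _ _) (M.expWelfare_nonneg _ _)
  · intro v
    simp only [hZt, Function.update_self]
    exact (M.integrable_welfare_update hF t _).add
      (M.integrable_expWelfare_comp hF _ (measurable_update _))
  · simp only [hZt, Function.update_self, ← M.expWelfare_eq_integral hF]
    exact M.integrable_expWelfare_comp hF _ hZ

variable (hIC : M.IsIC F) (hIR : M.IsIR)
  (hF : ∀ (t : Fin T) (i : Fin (k t)), Integrable (fun v : Val (k t) => (v i : ℝ)) (F t))
include hIC hIR hF

/-- The mean of the conditional expected utility does not change in a stage that is played after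
histories that were replaced by others, if these have the same conditional expected utility. -/
theorem IsIC.integral_condMean_stage (t : Fin T) {Z : Profile k → Profile k} (hZ : Measurable Z)
    (hZt : ∀ v a, Z (Function.update v t a) = Z v)
    (hi : Integrable (fun v => condMean F t M.totalUtil (Z v)) (Measure.pi F)) :
    Integrable (fun v => condMean F (t + 1) M.totalUtil (Function.update (Z v) t (v t)))
        (Measure.pi F) ∧
      ∫ v, condMean F (t + 1) M.totalUtil (Function.update (Z v) t (v t)) ∂(Measure.pi F)
        = ∫ v, condMean F t M.totalUtil (Z v) ∂(Measure.pi F) := by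
  have hm : Measurable fun v : Profile k =>
      condMean F (t + 1) M.totalUtil (Function.update (Z v) t (v t)) :=
    (measurable_condMean _ M.measurable_totalUtil).comp
      (measurable_update'.comp (hZ.prodMk (measurable_pi_apply t)))
  have := integral_resample (F := F) t hm (fun v => condMean_nonneg _ hIR _)
    (fun v => by
      simp only [hZt, Function.update_self]
      exact hIC.integrable_condMean_update hIR hF t _
        fun _ => hIC.integrable_totalUtil_mix hIR hF _ _)
    (by simpa only [hZt, Function.update_self, ← hIC.condMean_totalUtil_eq_integral hIR hF]
      using! hi)
  simpa only [hZt, Function.update_self, ← hIC.condMean_totalUtil_eq_integral hIR hF] using! this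

/-- Representatives can be selected, stage by stage, such that the balance almost surely stands for
the history `X`, whose conditional expected utility has the mean `M.utl F`, and such that the
welfare of the first `n` stages together with the welfare that `M` would achieve from `X` on is at
least that of `M`. -/
theorem IsIC.exists_representatives (n : ℕ) (hn : n ≤ T) :
    ∃ (r : Fin T → ℝ≥0 → Profile k) (hr : ∀ t, Measurable (r t)) (X : Profile k → Profile k),
      Measurable X ∧
      (∀ᵐ v ∂(Measure.pi F),
        M.Represents F n ((bankAccount hIC hIR hF r hr).bal n hn (take v n)) (X v)) ∧
      Integrable (fun v => condMean F n M.totalUtil (X v)) (Measure.pi F) ∧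
      ∫ v, condMean F n M.totalUtil (X v) ∂(Measure.pi F) = M.utl F ∧
      ∑ t, ∫ v, M.welfare t v ∂(Measure.pi F)
        ≤ ∑ t ∈ Finset.univ.filter (fun t : Fin T => (t : ℕ) < n),
            ∫ v, (bankAccount hIC hIR hF r hr).toDirect.welfare t v ∂(Measure.pi F)
          + ∫ v, M.expWelfare F n (X v) ∂(Measure.pi F) := by
  induction n with
  | zero =>
    -- The selectors are placeholders, replaced one per stage. The offset makes balance 0 stand for
    -- the empty history.
    refine ⟨fun _ _ => 0, fun _ => measurable_const, id, measurable_id, .of_forall fun v => ?_,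
      ?_, ?_, ?_⟩
    · simp [Represents, offset, condMean_zero, BankAccountMechanism.bal, utl]
    · simp [condMean_zero]
    · simp [condMean_zero, utl]
    · simp [M.expWelfare_zero hF]
  | succ n ih =>
    obtain ⟨r, hr, X, hX, hrep, hXi, hXu, hXw⟩ := ih (Nat.le_of_succ_le hn)
    set t : Fin T := ⟨n, hn⟩ with ht
    set B := bankAccount hIC hIR hF r hr with hB
    set Y : Profile k → ℝ≥0 := fun v => B.bal n (Nat.le_of_succ_le hn) (take v n) with hYdef
    have hY : Measurable Y := (B.measurable_bal n _).comp (measurable_take n)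
    have hYt : ∀ v a, Y (Function.update v t a) = Y v := fun v a => by
      simp only [hYdef]
      rw [take_update_of_le (show n ≤ (t : ℕ) from le_rfl)]
    -- `X` may depend on more than the balance; it is replaced by a function of the balance without
    -- loss of mean future welfare.
    obtain ⟨ρ, hρ, hρrep, hρw⟩ := exists_measurable_selection (Measure.pi F) hY hX
      (M.measurableSet_represents (F := F) n) hrep (M.measurable_expWelfare (F := F) n)
      (M.integrable_expWelfare_comp hF n hX)
    simp only [Set.mem_ofPred_eq] at hρrep
    have hZ : Measurable fun v => ρ (Y v) := hρ.comp hY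
    have hZt : ∀ v a, ρ (Y (Function.update v t a)) = ρ (Y v) := fun v a => by rw [hYt]
    have hr' : ∀ s, Measurable (Function.update r t ρ s) := fun s => by
      by_cases hs : s = t
      · subst hs; simpa using hρ
      · simpa [hs] using hr s
    -- Only the selector of stage `t` changes, so balances up to that stage and earlier welfare are
    -- the same for `C` and `B`.
    set C := bankAccount hIC hIR hF (Function.update r t ρ) hr' with hC
    have hne : ∀ s : Fin T, (s : ℕ) < n → s ≠ t := fun s hs e => by simp [e, ht] at hs
    have hupd : ∀ s : Fin T, (s : ℕ) < n → C.update s = B.update s := fun s hs => by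
      funext β a
      ext
      simp only [BankAccountMechanism.update, hC, hB, bankAccount,
        Function.update_of_ne (hne s hs)]
    have hbal : ∀ v, C.bal n (Nat.le_of_succ_le hn) (take v n) = Y v := fun v =>
      BankAccountMechanism.bal_congr _ hupd v
    have hwelf : ∀ s : Fin T, (s : ℕ) < n → C.toDirect.welfare s = B.toDirect.welfare s :=
        fun s hs => by
      funext v
      rw [BankAccountMechanism.welfare_toDirect, BankAccountMechanism.welfare_toDirect,
        BankAccountMechanism.bal_congr s.2.le (fun i hi => hupd i (hi.trans hs)) v, hC, hB,
        bankAccount_z, bankAccount_z, Function.update_of_ne (hne s hs)]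
    -- Both histories stand for the same balance.
    have hcond : (fun v => condMean F n M.totalUtil (ρ (Y v)))
        =ᵐ[Measure.pi F] fun v => condMean F n M.totalUtil (X v) := by
      filter_upwards [hρrep, hrep] with v h1 h2
      rw [← h1, ← h2]
    have hstage := hIC.integral_condMean_stage hIR hF t hZ hZt (hXi.congr hcond.symm)
    refine ⟨Function.update r t ρ, hr', fun v => Function.update (ρ (Y v)) t (v t),
      measurable_update'.comp (hZ.prodMk (measurable_pi_apply t)), ?_, hstage.1, ?_, ?_⟩
    · filter_upwards [hρrep] with v hv
      have := bankAccount_update_of_represents hIC hIR hF (Function.update r t ρ) hr' t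
        (β := Y v) (by simpa using hv) (v t)
      rw [Function.update_self, ← hbal v] at this
      rw [← hbal v]
      exact this
    · rw [← hXu, ← integral_congr_ae hcond]
      exact hstage.2
    · have hfil : Finset.univ.filter (fun s : Fin T => (s : ℕ) < n + 1)
          = insert t (Finset.univ.filter (fun s : Fin T => (s : ℕ) < n)) := by
        ext s
        simp only [Finset.mem_filter, Finset.mem_univ, true_and, Finset.mem_insert, Fin.ext_iff, ht]
        omega
      have hCt : C.toDirect.welfare t
          =ᵐ[Measure.pi F] fun v => M.welfare t (Function.update (ρ (Y v)) t (v t)) := by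
        filter_upwards [hρrep] with v hv
        have := bankAccount_welfare_of_represents hIC hIR hF (Function.update r t ρ) hr' t v
        rw [Function.update_self] at this
        have e : C.bal t t.2.le (take v t) = Y v := hbal v
        rw [← hC, e] at this
        exact this hv
      have hsum : ∑ s ∈ Finset.univ.filter (fun s : Fin T => (s : ℕ) < n),
            ∫ v, C.toDirect.welfare s v ∂(Measure.pi F)
          = ∑ s ∈ Finset.univ.filter (fun s : Fin T => (s : ℕ) < n),
            ∫ v, B.toDirect.welfare s v ∂(Measure.pi F) :=
        Finset.sum_congr rfl fun s hs => by rw [hwelf s (by simpa using hs)]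
      rw [hfil, Finset.sum_insert (by simp [ht]), integral_congr_ae hCt, hsum]
      have := integral_expWelfare_stage (M := M) hF t hZ hZt
      have e : ∫ v, M.expWelfare F n (ρ (Y v)) ∂(Measure.pi F)
          = ∫ v, M.expWelfare F t (ρ (Y v)) ∂(Measure.pi F) := rfl
      linarith

end DirectMechanism

end DynMech

open DynMech in
theorem theorem1 {T : ℕ} (k : Fin T → ℕ)
    (F : (t : Fin T) → MeasureTheory.Measure (DynMech.Val (k t)))
    [∀ t, MeasureTheory.IsProbabilityMeasure (F t)]
    (hF : ∀ (t : Fin T) (i : Fin (k t)),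
      MeasureTheory.Integrable (fun v : DynMech.Val (k t) => (v i : ℝ)) (F t))
    (M : DynMech.DirectMechanism k) (hIC : M.IsIC F) (hIR : M.IsIR) :
    M.HasFiniteExpectations F ∧
    ∃ B : DynMech.BankAccountMechanism k,
      B.IsBAM F ∧
      B.toDirect.HasFiniteExpectations F ∧
      M.rev F ≤ B.toDirect.rev F ∧
      B.toDirect.utl F = M.utl F ∧
      (M.IsDeterministic → B.IsDeterministic) := by
  have hMi : Integrable M.totalUtil (Measure.pi F) := by
    rcases isEmpty_or_nonempty (Profile k) with h | ⟨⟨v⟩⟩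
    · exact Integrable.of_isEmpty
    · simpa only [mix_zero] using hIC.integrable_totalUtil_mix hIR hF 0 v
  have hM := DirectMechanism.hasFiniteExpectations_of_integrable_totalUtil hF hMi
  obtain ⟨r, hr, X, hX, hrep, hXi, hXu, hXw⟩ := hIC.exists_representatives hIR hF T le_rfl
  set B := DirectMechanism.bankAccount hIC hIR hF r hr with hB
  -- Only `T = 0` needs an argument: without stages the utility is zero.
  have hoff : M.offset F T = 0 := by
    unfold DirectMechanism.offset
    split_ifs with h
    · subst h
      simp [DirectMechanism.utl, DirectMechanism.totalUtil]
    · rfl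
  -- After the last stage nothing is random, and the final balance is both the utility that `M`
  -- gives at `X v` and the realized utility under `B`.
  have hBu : (fun v => condMean F T M.totalUtil (X v)) =ᵐ[Measure.pi F] B.toDirect.totalUtil := by
    filter_upwards [hrep] with v hv
    rw [B.totalUtil_toDirect (fun t β a => by
      rw [hB, DirectMechanism.bankAccount_d, DirectMechanism.bankAccount_uHat_self]), ← hv, hoff,
      add_zero]
  have hBf := DirectMechanism.hasFiniteExpectations_of_integrable_totalUtil hF (hXi.congr hBu)
  have hutl : B.toDirect.utl F = M.utl F := by
    rw [← hXu, DirectMechanism.utl, integral_congr_ae hBu]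
  refine ⟨hM.1, B, DirectMechanism.isBAM_bankAccount hIC hIR hF r hr, hBf.1, ?_, hutl,
    DirectMechanism.isDeterministic_bankAccount hIC hIR hF r hr⟩
  rw [hM.2, hBf.2, hutl]
  rw [Finset.filter_true_of_mem fun t _ => t.2] at hXw
  simp only [M.expWelfare_of_le le_rfl, integral_zero, add_zero] at hXw
  linarith
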